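/- Let $X$ be a separable, infinite-dimensional Banach space over $\mathbb{F}\in\{\mathbb{R},\mathbb{C}\}$. For bounded linear operators on $X$, write $\mathcal{HC}(T)$ for the set of $x\in X$ whose orbit $\{T^n x : n\in\mathbb{N}\}$ is dense in $X$, and $\text{d-}\mathcal{HC}(T_1,T_2)$ for the set of $x\in X$ such that $\{(T_1^n x, T_2^n x) : n\in\mathbb{N}\}$ is dense in $X\times X$. Call $T_1,T_2$ densely d-hypercyclic if $\text{d-}\mathcal{HC}(T_1,T_2)$ is dense in $X$. A hypercyclic subspace of $T$ is a closed infinite-dimensional linear subspace $Y\subseteq X$ with $Y\setminus\{0\}\subseteq\mathcal{HC}(T)$; a d-hypercyclic subspace of $T_1,T_2$ is a closed infinite-dimensional linear subspace $Y\subseteq X$ with $Y\setminus\{0\}\subseteq\text{d-}\mathcal{HC}(T_1,T_2)$. Then there exist bounded linear operators $T_1,T_2$ on $X$ that are densely d-hypercyclic and have a common hypercyclic subspace (a single $Y$ that is a hypercyclic subspace of both $T_1$ and $T_2$), but have no d-hypercyclic subspace. Moreover, $T_1,T_2$ can be chosen so that, in addition, every nonzero linear subspace (closed or not) of $X$ contained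 in $\text{d-}\mathcal{HC}(T_1,T_2)\cup\{0\}$ is one-dimensional. -/

import Mathlib

/-- The set `HC(T)` of hypercyclic vectors of a bounded operator `T`: the vectors `x` whose orbit
`{T ^ n x : n ∈ ℕ}` is dense. -/
def hypercyclicVectors {𝕜 X : Type*} [RCLike 𝕜] [NormedAddCommGroup X] [NormedSpace 𝕜 X]
    (T : X →L[𝕜] X) : Set X :=
  {x | Dense (Set.range fun n : ℕ => (T ^ n) x)}

/-- The set `d-HC(T_1, …, T_N)` of d-hypercyclic vectors of bounded operators `T_1, …, T_N`: the
vectors `x` for which `{(T_1 ^ n x, …, T_N ^ n x) : n ∈ ℕ}` is dense in the product space `X ^ N`. -/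
def dHypercyclicVectors {𝕜 X : Type*} [RCLike 𝕜] [NormedAddCommGroup X] [NormedSpace 𝕜 X]
    {N : ℕ} (T : Fin N → (X →L[𝕜] X)) : Set X :=
  {x | Dense (Set.range fun n : ℕ => fun i : Fin N => (T i ^ n) x)}

/-- The operators are densely d-hypercyclic if their d-hypercyclic vectors are dense in `X`. -/
def DenselyDHypercyclic {𝕜 X : Type*} [RCLike 𝕜] [NormedAddCommGroup X] [NormedSpace 𝕜 X]
    {N : ℕ} (T : Fin N → (X →L[𝕜] X)) : Prop :=
  Dense (dHypercyclicVectors T)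

/-- A hypercyclic subspace of `T`: a closed infinite-dimensional subspace all of whose nonzero
vectors are hypercyclic for `T`. -/
def IsHypercyclicSubspace {𝕜 X : Type*} [RCLike 𝕜] [NormedAddCommGroup X] [NormedSpace 𝕜 X]
    (T : X →L[𝕜] X) (Y : Submodule 𝕜 X) : Prop :=
  IsClosed (Y : Set X) ∧ ¬ FiniteDimensional 𝕜 Y ∧
    ∀ y ∈ Y, y ≠ 0 → y ∈ hypercyclicVectors T

/-- A d-hypercyclic subspace: a closed infinite-dimensional subspace all of whose nonzero
vectors are d-hypercyclic for the given operators. -/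
def IsDHypercyclicSubspace {𝕜 X : Type*} [RCLike 𝕜] [NormedAddCommGroup X] [NormedSpace 𝕜 X]
    {N : ℕ} (T : Fin N → (X →L[𝕜] X)) (Y : Submodule 𝕜 X) : Prop :=
  IsClosed (Y : Set X) ∧ ¬ FiniteDimensional 𝕜 Y ∧
    ∀ y ∈ Y, y ≠ 0 → y ∈ dHypercyclicVectors T

/-! Take `T` with two properties: it is the identity on a closed infinite-dimensional `M`, and its
diagonal action on `ℓ¹(ℕ, X)` has a dense orbit, that of `h`. Put `T₁ = T` and `T₂ = L⁻¹TL` with `L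
= 1 + f ⊗ v`, `f ≠ 0`, `v` a multiple of `h 0`. Absorbing the scalar into `f`, `T₂ⁿx = L⁻¹(Tⁿx +
f(x)Tⁿ(h 0))`. If `f x = 0`, the joint orbit stays in the graph of `L⁻¹`; hence `f` is injective on
every subspace of d-hypercyclic vectors and zero, which leaves dimension at most one. If `f x ≠ 0`,
density of `(Tⁿx, Tⁿ(h 0))` suffices, and `x = h 1 + Tᵏ(h 0)` supplies a dense set of candidates.
For the common subspace, let `S = 1 + cR` be invertible with `R m = ∑ fᵢ(m) hᵢ`. On `M`, `TⁿSm = m +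
c ∑ fᵢ(m) Tⁿhᵢ`, so `S(M)` is a hypercyclic subspace of `T`; on `S(M) ∩ ker f`, `L` is the identity
and `T₂` inherits hypercyclicity. The operator is `T = exp B`, where `B` acts as `d/dx` on
infinitely many copies of the polynomials; `M = ker B`, and two-point interpolation gives mixing
(`exists_operator_dense_diagonal_orbit`). -/

/-! ### Mixing criterion for dense orbits -/

section Transitivity

open Filter Topology Set

variable {𝕜 E : Type*} [RCLike 𝕜] [NormedAddCommGroup E] [NormedSpace 𝕜 E]

/-- The pairs `(x, y)` for which there are `z n → x` with `T ^ n (z n) → y`. -/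
def orbitLimitPairs (T : E →L[𝕜] E) : Submodule 𝕜 (E × E) where
  carrier := {p | ∃ z : ℕ → E, Tendsto z atTop (𝓝 p.1) ∧
    Tendsto (fun n => (T ^ n) (z n)) atTop (𝓝 p.2)}
  add_mem' := by
    rintro p q ⟨z, hz, hz'⟩ ⟨w, hw, hw'⟩
    exact ⟨fun n => z n + w n, hz.add hw, by simpa using hz'.add hw'⟩
  zero_mem' := ⟨fun _ => 0, by simp, by simp⟩
  smul_mem' := by
    rintro c p ⟨z, hz, hz'⟩
    exact ⟨fun n => c • z n, hz.const_smul c, by simpa using hz'.const_smul c⟩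

theorem mem_orbitLimitPairs {T : E →L[𝕜] E} {x y : E} :
    (x, y) ∈ orbitLimitPairs T ↔ ∃ z : ℕ → E, Tendsto z atTop (𝓝 x) ∧
      Tendsto (fun n => (T ^ n) (z n)) atTop (𝓝 y) := Iff.rfl

/-- Linearity of the limit relation, through `(x, y) = (x, 0) + (0, y)`, reduces mixing to
generators. -/
theorem mem_orbitLimitPairs_of_mem_span {T : E →L[𝕜] E} {D : Set E}
    (hD : ∀ d ∈ D, (d, 0) ∈ orbitLimitPairs T ∧ (0, d) ∈ orbitLimitPairs T) {x y : E}
    (hx : x ∈ Submodule.span 𝕜 D) (hy : y ∈ Submodule.span 𝕜 D) :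
    (x, y) ∈ orbitLimitPairs T := by
  have h1 : Submodule.span 𝕜 D ≤ (orbitLimitPairs T).comap (LinearMap.inl 𝕜 E E) :=
    Submodule.span_le.2 fun d hd => (hD d hd).1
  have h2 : Submodule.span 𝕜 D ≤ (orbitLimitPairs T).comap (LinearMap.inr 𝕜 E E) :=
    Submodule.span_le.2 fun d hd => (hD d hd).2
  simpa using (orbitLimitPairs T).add_mem (h1 hx) (h2 hy)

/-- A mixing criterion giving a vector with dense orbit. -/
theorem exists_dense_orbit [CompleteSpace E] (T : E →L[𝕜] E) {D : Set E} (hc : D.Countable)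
    (hdense : Dense (Submodule.span 𝕜 D : Set E))
    (hD : ∀ d ∈ D, (d, 0) ∈ orbitLimitPairs T ∧ (0, d) ∈ orbitLimitPairs T) :
    ∃ x : E, Dense (range fun n : ℕ => (T ^ n) x) := by
  have hsep : TopologicalSpace.SeparableSpace E := by
    have h1 : TopologicalSpace.IsSeparable (Submodule.span 𝕜 D : Set E) :=
      hc.isSeparable.span
    have h2 := h1.closure
    rw [hdense.closure_eq] at h2
    exact TopologicalSpace.isSeparable_univ_iff.1 h2
  have : SecondCountableTopology E := UniformSpace.secondCountable_of_separable E
  set b := TopologicalSpace.countableBasis E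
  have hb : TopologicalSpace.IsTopologicalBasis b := TopologicalSpace.isBasis_countableBasis E
  have hbc : b.Countable := TopologicalSpace.countable_countableBasis E
  -- Baire category: vectors whose orbit meets every basic open set form a dense Gδ.
  have key : Dense (⋂ V ∈ b, ⋃ n : ℕ, (fun x => (T ^ n) x) ⁻¹' V) := by
    refine dense_biInter_of_isOpen (fun V hV => isOpen_iUnion fun n =>
      (hb.isOpen hV).preimage (T ^ n).continuous) hbc fun V hV => ?_
    rw [dense_iff_inter_open]
    intro U hU hUne
    obtain ⟨x, hxU, hx⟩ := hdense.inter_open_nonempty U hU hUne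
    obtain ⟨y, hyV, hy⟩ := hdense.inter_open_nonempty V (hb.isOpen hV)
      (TopologicalSpace.nonempty_of_mem_countableBasis hV)
    obtain ⟨z, hz, hz'⟩ := mem_orbitLimitPairs_of_mem_span hD hx hy
    obtain ⟨n, hn1, hn2⟩ := ((hz.eventually (hU.mem_nhds hxU)).and
      (hz'.eventually ((hb.isOpen hV).mem_nhds hyV))).exists
    exact ⟨z n, hn1, mem_iUnion.2 ⟨n, hn2⟩⟩
  obtain ⟨x, hx⟩ := key.nonempty
  refine ⟨x, hb.dense_iff.2 fun V hV _ => ?_⟩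
  obtain ⟨n, hn⟩ := mem_iUnion.1 (mem_iInter₂.1 hx V hV)
  exact ⟨_, hn, n, rfl⟩

end Transitivity

/-! ### Fundamental biorthogonal sequences -/

section Biorthogonal

open Set

variable {𝕜 X : Type*} [RCLike 𝕜] [NormedAddCommGroup X] [NormedSpace 𝕜 X]

theorem exists_linearIndependent_dense_span [TopologicalSpace.SeparableSpace X]
    (hX : ¬ FiniteDimensional 𝕜 X) :
    ∃ x : ℕ → X, LinearIndependent 𝕜 x ∧ Dense (Submodule.span 𝕜 (range x) : Set X) := by
  obtain ⟨b, hb, hspan, hli⟩ :=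
    exists_linearIndependent 𝕜 (range (TopologicalSpace.denseSeq X))
  have hd : Dense (Submodule.span 𝕜 b : Set X) := by
    rw [hspan]
    exact (TopologicalSpace.denseRange_denseSeq X).mono Submodule.subset_span
  have hbc : b.Countable := (countable_range _).mono hb
  have hinf : b.Infinite := by
    intro hfin
    apply hX
    have : FiniteDimensional 𝕜 (Submodule.span 𝕜 b) := FiniteDimensional.span_of_finite 𝕜 hfin
    have hcl := (Submodule.closed_of_finiteDimensional (Submodule.span 𝕜 b)).closure_eq
    rw [hd.closure_eq] at hcl
    have htop : Submodule.span 𝕜 b = ⊤ := SetLike.coe_injective (by simpa using hcl.symm)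
    rw [htop] at this
    exact Module.finite_def.2 ((Submodule.fg_top _).1 (Module.finite_def.1 this))
  have := hbc.to_subtype
  have := hinf.to_subtype
  obtain ⟨φ⟩ := nonempty_equiv_of_countable (α := ℕ) (β := b)
  refine ⟨fun n => φ n, hli.comp φ φ.injective, ?_⟩
  have : range (fun n => (φ n : X)) = b := by
    rw [← Function.comp_def, range_comp, φ.surjective.range_eq]; simp
  rwa [this]

/-- Hahn–Banach extension of the last coordinate functional on the span of `x 0, …, x n`. -/
theorem LinearIndependent.exists_triangular_dual {x : ℕ → X} (hx : LinearIndependent 𝕜 x)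
    (n : ℕ) : ∃ g : StrongDual 𝕜 X, g (x n) = 1 ∧ ∀ k < n, g (x k) = 0 := by
  have hli : LinearIndependent 𝕜 (fun i : Fin (n + 1) => x i) :=
    hx.comp _ Fin.val_injective
  have hinj : Function.Injective (Fintype.linearCombination 𝕜 (fun i : Fin (n + 1) => x i)) :=
    LinearIndependent.fintypeLinearCombination_injective hli
  obtain ⟨g, hg⟩ := (SeparatingDual.dualMap_surjective_iff (R := 𝕜)).2 hinj
    (LinearMap.proj (Fin.last n))
  have key (i : Fin (n + 1)) : g (x i) = (Pi.single i (1 : 𝕜) : Fin (n + 1) → 𝕜) (Fin.last n) := by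
    have := LinearMap.congr_fun hg (Pi.single i 1)
    simpa using this
  refine ⟨g, by simpa using key (Fin.last n), fun k hk => ?_⟩
  have := key ⟨k, hk.trans n.lt_succ_self⟩
  rw [Pi.single_eq_of_ne] at this
  · exact this
  · intro h
    simp [Fin.ext_iff] at h
    omega

theorem exists_sub_mem_span_annihilated {x : ℕ → X} {g : ℕ → StrongDual 𝕜 X}
    (h1 : ∀ n, g n (x n) = 1) (h0 : ∀ n, ∀ k < n, g n (x k) = 0) (n : ℕ) (v : X) :
    ∃ w ∈ Submodule.span 𝕜 (x '' Iio n), ∀ k < n, g k (v - w) = 0 := by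
  induction n generalizing v with
  | zero => exact ⟨0, zero_mem _, by simp⟩
  | succ n ih =>
    have hmono : Submodule.span 𝕜 (x '' Iio n) ≤ Submodule.span 𝕜 (x '' Iio (n + 1)) :=
      Submodule.span_mono (image_mono (Iio_subset_Iio n.le_succ))
    have hvan : Submodule.span 𝕜 (x '' Iio n) ≤ LinearMap.ker (g n : X →ₗ[𝕜] 𝕜) := by
      rw [Submodule.span_le]
      rintro _ ⟨k, hk, rfl⟩
      exact h0 n k hk
    obtain ⟨w, hw, hw'⟩ := ih v
    obtain ⟨y, hy, hy'⟩ := ih (x n)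
    have hgy : g n y = 0 := hvan hy
    -- Gram–Schmidt step: `x n - y` is killed by the earlier functionals and has `g n`-value 1.
    refine ⟨w + g n (v - w) • (x n - y), add_mem (hmono hw) (Submodule.smul_mem _ _
      (sub_mem (Submodule.subset_span ⟨n, by simp, rfl⟩) (hmono hy))), fun k hk => ?_⟩
    rw [← sub_sub, map_sub, map_smul]
    rcases Nat.lt_succ_iff_lt_or_eq.1 hk with hk | rfl
    · rw [hw' k hk, hy' k hk]; simp
    · rw [map_sub _ (x k) y, h1, hgy]; simp

/-- A separable infinite-dimensional normed space has a fundamental biorthogonal sequence. -/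
theorem exists_biorthogonal [TopologicalSpace.SeparableSpace X]
    (hX : ¬ FiniteDimensional 𝕜 X) :
    ∃ (e : ℕ → X) (g : ℕ → StrongDual 𝕜 X), (∀ i j, g i (e j) = if i = j then 1 else 0) ∧
      Dense (Submodule.span 𝕜 (range e) : Set X) := by
  obtain ⟨x, hx, hd⟩ := exists_linearIndependent_dense_span hX
  choose g h1 h0 using hx.exists_triangular_dual
  choose w hw hw' using fun n => exists_sub_mem_span_annihilated h1 h0 n (x n)
  have hvan {i j : ℕ} (hij : j ≤ i) : g i (w j) = 0 := by
    have : Submodule.span 𝕜 (x '' Iio j) ≤ LinearMap.ker (g i : X →ₗ[𝕜] 𝕜) := by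
      rw [Submodule.span_le]
      rintro _ ⟨k, hk, rfl⟩
      exact h0 i k (lt_of_lt_of_le hk hij)
    exact this (hw j)
  refine ⟨fun n => x n - w n, g, fun i j => ?_, ?_⟩
  · rcases lt_trichotomy i j with h | rfl | h
    · rw [hw' j i h, if_neg h.ne]
    · simp [h1, hvan le_rfl]
    · rw [map_sub, h0 i j h, hvan h.le, if_neg h.ne', sub_zero]
  · refine hd.mono ?_
    rw [SetLike.coe_subset_coe, Submodule.span_le]
    rintro _ ⟨n, rfl⟩
    induction n using Nat.strong_induction_on with
    | _ n ih =>
      have hwn : w n ∈ Submodule.span 𝕜 (range fun n => x n - w n) := by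
        refine Submodule.span_le.2 ?_ (hw n)
        rintro _ ⟨k, hk, rfl⟩
        exact ih k hk
      have := add_mem (Submodule.subset_span (mem_range_self (f := fun n => x n - w n) n)) hwn
      simpa using this

end Biorthogonal

/-! ### Hermite interpolation and dilation of polynomials -/

section Interpolation

open Polynomial

variable {𝕜 : Type*} [Field 𝕜]

/-- A two-point Hermite interpolation polynomial. -/
theorem Polynomial.exists_hermite_pair (j : ℕ) (a b : 𝕜) :
    ∃ H K Q : 𝕜[X], H = a • X ^ j + X ^ (j + 1) * K ∧
      taylor 1 H = b • X ^ j + X ^ (j + 1) * Q := by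
  have hcop : IsCoprime (X ^ (j + 1) : 𝕜[X]) ((X - 1) ^ (j + 1)) :=
    IsCoprime.pow ⟨1, -1, by ring⟩
  obtain ⟨u, v, huv⟩ := hcop
  -- Chinese remainder solution: `a X^j` modulo `X^(j+1)` and `b (X-1)^j` modulo `(X-1)^(j+1)`.
  refine ⟨a • X ^ j * (v * (X - 1) ^ (j + 1)) + b • (X - 1) ^ j * (u * X ^ (j + 1)),
    b • (X - 1) ^ j * u - a • X ^ j * u,
    a • (taylor 1 X) ^ j * taylor 1 v - b • X ^ j * taylor 1 v, ?_, ?_⟩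
  · have : v * (X - 1) ^ (j + 1) = 1 - u * X ^ (j + 1) := by linear_combination huv
    rw [this]
    simp only [smul_eq_C_mul]
    ring
  · have hX : taylor (1 : 𝕜) (X - 1) = X := by simp
    have h : taylor 1 u * (taylor (1 : 𝕜) X) ^ (j + 1) =
        1 - taylor 1 v * X ^ (j + 1) := by
      have := congrArg (taylor (1 : 𝕜)) huv
      rw [map_add, taylor_mul, taylor_mul, taylor_pow, taylor_pow, hX, taylor_one, C_1] at this
      linear_combination this
    simp only [map_add, taylor_mul, taylor_pow, map_smul, hX, h]
    simp only [smul_eq_C_mul]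
    ring

/-- The polynomial `c ^ j * p (x / c)`. -/
noncomputable def Polynomial.dilate (j : ℕ) (c : 𝕜) : 𝕜[X] →ₗ[𝕜] 𝕜[X] :=
  c ^ j • (aeval (C c⁻¹ * X) : 𝕜[X] →ₐ[𝕜] 𝕜[X]).toLinearMap

theorem Polynomial.dilate_apply (j : ℕ) (c : 𝕜) (p : 𝕜[X]) :
    dilate j c p = c ^ j • p.comp (C c⁻¹ * X) := rfl

theorem Polynomial.dilate_X_pow (j i : ℕ) (c : 𝕜) :
    dilate j c (X ^ i : 𝕜[X]) = (c ^ j * c⁻¹ ^ i) • X ^ i := by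
  rw [dilate_apply, X_pow_comp, mul_pow, ← C_pow, ← smul_eq_C_mul, smul_smul]

theorem Polynomial.taylor_dilate (j : ℕ) {c : 𝕜} (hc : c ≠ 0) (p : 𝕜[X]) :
    taylor c (dilate j c p) = dilate j c (taylor 1 p) := by
  simp only [dilate_apply, map_smul, taylor_apply, comp_assoc]
  congr 2
  simp [mul_add, ← C_mul, hc]

end Interpolation

/-! ### The exponential of a differentiation-like operator -/

section Exponential

open Polynomial Filter Topology
open scoped Nat

variable {𝕜 X : Type*} [RCLike 𝕜] [NormedAddCommGroup X] [NormedSpace 𝕜 X]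

theorem Polynomial.sum_iterate_derivative_eq_taylor {p : 𝕜[X]} {N : ℕ} (hN : p.natDegree < N) :
    ∑ k ∈ Finset.range N, (k ! : 𝕜)⁻¹ • derivative^[k] p = taylor 1 p := by
  ext m
  have hdeg : (hasseDeriv m p).natDegree < N :=
    ((natDegree_hasseDeriv_le p m).trans (Nat.sub_le _ _)).trans_lt hN
  rw [taylor_coeff, eval_eq_sum_range' hdeg, finsetSum_coeff]
  refine Finset.sum_congr rfl fun k _ => ?_
  have hk : (k ! : 𝕜) ≠ 0 := Nat.cast_ne_zero.2 k.factorial_ne_zero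
  rw [coeff_smul, coeff_iterate_derivative, hasseDeriv_coeff, Nat.descFactorial_eq_factorial_mul_choose,
    one_pow, mul_one, nsmul_eq_mul, smul_eq_mul, Nat.cast_mul, mul_assoc, inv_mul_cancel_left₀ hk,
    add_comm k m, Nat.choose_symm_add]

/-- Dilation by `n` fixes `X^j` and multiplies each higher monomial by a negative power of `n`. -/
theorem tendsto_dilate_X_pow_mul (Φ : 𝕜[X] →ₗ[𝕜] X) (j : ℕ) (K : 𝕜[X]) :
    Tendsto (fun n : ℕ => Φ (dilate j (n : 𝕜) (Polynomial.X ^ (j + 1) * K))) atTop (𝓝 0) := by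
  induction K using Polynomial.induction_on' with
  | add p q hp hq => simpa [mul_add] using hp.add hq
  | monomial i a =>
    have h (n : ℕ) : Φ (dilate j (n : 𝕜) (Polynomial.X ^ (j + 1) * monomial i a)) =
        (a * ((n : 𝕜) ^ j * (n : 𝕜)⁻¹ ^ (j + 1 + i))) • Φ (Polynomial.X ^ (j + 1 + i)) := by
      rw [← C_mul_X_pow_eq_monomial, mul_left_comm, ← pow_add, ← smul_eq_C_mul, map_smul,
        dilate_X_pow, map_smul, map_smul, smul_smul]
    have hinv : Tendsto (fun n : ℕ => ((n : 𝕜))⁻¹) atTop (𝓝 0) := tendsto_inv_atTop_nhds_zero_nat (𝕜 := 𝕜)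
    have hlim : Tendsto (fun n : ℕ => (n : 𝕜) ^ j * (n : 𝕜)⁻¹ ^ (j + 1 + i)) atTop (𝓝 0) := by
      have := hinv.pow (i + 1)
      rw [zero_pow i.succ_ne_zero] at this
      refine this.congr' ((eventually_ne_atTop 0).mono fun n hn => ?_)
      have hn' : (n : 𝕜) ≠ 0 := Nat.cast_ne_zero.2 hn
      beta_reduce
      rw [show j + 1 + i = j + (i + 1) by ring, pow_add _ j, ← mul_assoc, ← mul_pow,
        mul_inv_cancel₀ hn', one_pow, one_mul]
    simp only [h]
    simpa using (hlim.const_mul a).smul_const (Φ (Polynomial.X ^ (j + 1 + i)))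

variable [CompleteSpace X]

/-- The exponential of a bounded operator. -/
noncomputable def expOperator (B : X →L[𝕜] X) : X →L[𝕜] X :=
  ∑' k : ℕ, (k ! : 𝕜)⁻¹ • B ^ k

theorem expOperator_apply_of_forall_ge (B : X →L[𝕜] X) {x : X} {N : ℕ}
    (h : ∀ k ≥ N, (B ^ k) x = 0) :
    expOperator B x = ∑ k ∈ Finset.range N, (k ! : 𝕜)⁻¹ • (B ^ k) x := by
  have h1 : HasSum (fun k : ℕ => (k ! : 𝕜)⁻¹ • B ^ k) (expOperator B) :=
    (NormedSpace.expSeries_summable' (𝕂 := 𝕜) B).hasSum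
  have h2 := h1.mapL (ContinuousLinearMap.apply 𝕜 X x)
  refine h2.unique (hasSum_sum_of_ne_finset_zero fun k hk => ?_)
  simp [h k (by simpa using hk)]

theorem expOperator_apply_of_apply_eq_zero {B : X →L[𝕜] X} {x : X} (h : B x = 0) :
    expOperator B x = x := by
  rw [expOperator_apply_of_forall_ge B (N := 1)]
  · simp
  · intro k hk
    obtain ⟨k, rfl⟩ := Nat.exists_eq_add_of_le' hk
    rw [pow_succ, mul_apply_eq_comp, h, map_zero]

/-- Taylor's formula: the exponential of `d/dx` is translation by 1. -/
theorem expOperator_pow_apply {B : X →L[𝕜] X} {Φ : 𝕜[X] →ₗ[𝕜] X}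
    (hΦ : ∀ p, B (Φ p) = Φ (derivative p)) (n : ℕ) (p : 𝕜[X]) :
    (expOperator B ^ n) (Φ p) = Φ (taylor (n : 𝕜) p) := by
  have hB (k : ℕ) (p : 𝕜[X]) : (B ^ k) (Φ p) = Φ (derivative^[k] p) := by
    induction k generalizing p with
    | zero => simp
    | succ k ih => rw [pow_succ, mul_apply_eq_comp, hΦ, ih, Function.iterate_succ_apply]
  have h1 (p : 𝕜[X]) : expOperator B (Φ p) = Φ (taylor 1 p) := by
    rw [expOperator_apply_of_forall_ge B (N := p.natDegree + 1),
      ← sum_iterate_derivative_eq_taylor p.natDegree.lt_succ_self]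
    · simp [hB]
    · intro k hk
      rw [hB, iterate_derivative_eq_zero hk, map_zero]
  induction n generalizing p with
  | zero => simp
  | succ n ih =>
    rw [pow_succ, mul_apply_eq_comp, h1, ih, taylor_taylor]
    simp

/-- Dilating the Hermite polynomial by `n` moves its second node from 1 to `n`, where the
translation by `n` reads it off. -/
theorem mem_orbitLimitPairs_expOperator {B : X →L[𝕜] X} {Φ : 𝕜[X] →ₗ[𝕜] X}
    (hΦ : ∀ p, B (Φ p) = Φ (derivative p)) (j : ℕ) (a b : 𝕜) :
    (a • Φ (Polynomial.X ^ j), b • Φ (Polynomial.X ^ j)) ∈ orbitLimitPairs (expOperator B) := by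
  obtain ⟨H, K, Q, hH, hH'⟩ := exists_hermite_pair j a b
  have hlim (c : 𝕜) (K : 𝕜[X]) : Tendsto (fun n : ℕ => Φ (dilate j (n : 𝕜)
      (c • Polynomial.X ^ j + Polynomial.X ^ (j + 1) * K))) atTop
      (𝓝 (c • Φ (Polynomial.X ^ j))) := by
    have := (tendsto_const_nhds (x := c • Φ (Polynomial.X ^ j))).add
      (tendsto_dilate_X_pow_mul Φ j K)
    rw [add_zero] at this
    refine this.congr' ((eventually_ne_atTop 0).mono fun n hn => ?_)
    have hn' : (n : 𝕜) ≠ 0 := Nat.cast_ne_zero.2 hn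
    simp [dilate_X_pow, hn']
  refine ⟨fun n => Φ (dilate j (n : 𝕜) H), hH ▸ hlim a K, (hlim b Q).congr'
    ((eventually_ne_atTop 0).mono fun n hn => ?_)⟩
  have hn' : (n : 𝕜) ≠ 0 := Nat.cast_ne_zero.2 hn
  change _ = (expOperator B ^ n) (Φ (dilate j (n : 𝕜) H))
  rw [expOperator_pow_apply hΦ, taylor_dilate j hn', hH']

end Exponential

/-! ### The operator `T` and its diagonal action on `ℓ¹(ℕ, X)` -/

section Construction

open Filter Topology Set

variable {𝕜 X : Type*} [RCLike 𝕜] [NormedAddCommGroup X] [NormedSpace 𝕜 X]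

/-- A backward shift with infinitely many strands, along a linearly independent family
with dense span. -/
theorem exists_backward_shift [CompleteSpace X] [TopologicalSpace.SeparableSpace X]
    (hX : ¬ FiniteDimensional 𝕜 X) :
    ∃ (B : X →L[𝕜] X) (u : ℕ × ℕ → X), LinearIndependent 𝕜 u ∧
      Dense (Submodule.span 𝕜 (range u) : Set X) ∧ (∀ i, B (u (i, 0)) = 0) ∧
      ∀ i j, B (u (i, j + 1)) = ((j + 1 : ℕ) : 𝕜) • u (i, j) := by
  obtain ⟨e₀, g₀, hbi₀, hd₀⟩ := exists_biorthogonal hX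
  set e : ℕ × ℕ → X := fun p => e₀ (Nat.pairEquiv p)
  set g : ℕ × ℕ → StrongDual 𝕜 X := fun p => g₀ (Nat.pairEquiv p)
  have hbi (p q : ℕ × ℕ) : g p (e q) = if p = q then 1 else 0 := by
    simp only [g, e, hbi₀, Nat.pairEquiv.injective.eq_iff]
  have hd : Dense (Submodule.span 𝕜 (range e) : Set X) := by
    have : range e = range e₀ := Nat.pairEquiv.surjective.range_comp e₀
    rwa [this]
  have hli : LinearIndependent 𝕜 e := by
    refine LinearIndependent.of_pairwise_dual_eq_zero_one e (fun p => (g p : X →ₗ[𝕜] 𝕜)) ?_ ?_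
    · intro p q hpq
      simp [hbi, hpq]
    · intro p
      simp [hbi]
  obtain ⟨δ, hδ, c, hc, -⟩ := posSumOfEncodable one_pos (ℕ × ℕ)
  -- These weights force `‖F p‖ ≤ δ p`, so the shift is an absolutely convergent sum.
  set w : ℕ × ℕ → ℝ := fun p => δ p / (1 + ‖g (p.1, p.2 + 1)‖ * ‖e p‖)
  have hw (p : ℕ × ℕ) : (w p : 𝕜) ≠ 0 := by
    have : 0 < w p := div_pos (hδ p) (by positivity)
    exact_mod_cast this.ne'
  set F : ℕ × ℕ → X →L[𝕜] X := fun p => (w p : 𝕜) • (g (p.1, p.2 + 1)).smulRight (e p)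
  have hF : Summable F := by
    refine Summable.of_norm_bounded hc.summable fun p => ?_
    have hpos : 0 < 1 + ‖g (p.1, p.2 + 1)‖ * ‖e p‖ := by positivity
    rw [norm_smul, ContinuousLinearMap.norm_smulRight_apply, RCLike.norm_ofReal,
      abs_of_pos (div_pos (hδ p) hpos), div_mul_eq_mul_div, div_le_iff₀ hpos]
    exact mul_le_mul_of_nonneg_left (by linarith) (hδ p).le
  have happ (x : X) : HasSum (fun p => F p x) ((∑' p, F p) x) :=
    hF.hasSum.mapL (ContinuousLinearMap.apply 𝕜 X x)
  have hFe (p q : ℕ × ℕ) : F p (e q) = if (p.1, p.2 + 1) = q then (w p : 𝕜) • e p else 0 := by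
    simp only [F, smul_apply, ContinuousLinearMap.smulRight_apply, hbi]
    split_ifs <;> simp
  -- Solves `a (i, j+1) * w (i, j) = (j+1) * a (i, j)`, so that `a • e` behaves like the monomials
  -- under `d/dx`.
  set a : ℕ × ℕ → 𝕜 := fun p =>
    (p.2.factorial : 𝕜) * ∏ l ∈ Finset.range p.2, (w (p.1, l) : 𝕜)⁻¹
  have ha (p : ℕ × ℕ) : a p ≠ 0 :=
    mul_ne_zero (Nat.cast_ne_zero.2 p.2.factorial_ne_zero)
      (Finset.prod_ne_zero_iff.2 fun l _ => inv_ne_zero (hw _))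
  refine ⟨∑' p, F p, fun p => a p • e p, ?_, ?_, fun i => ?_, fun i j => ?_⟩
  · exact hli.units_smul fun p => Units.mk0 (a p) (ha p)
  · refine hd.mono ?_
    rw [SetLike.coe_subset_coe, Submodule.span_le]
    rintro _ ⟨p, rfl⟩
    have := Submodule.smul_mem _ (a p)⁻¹
      (Submodule.subset_span (R := 𝕜) (mem_range_self (f := fun p => a p • e p) p))
    rwa [inv_smul_smul₀ (ha p)] at this
  · have : (∑' p, F p) (e (i, 0)) = 0 := by
      refine (happ _).unique ?_
      simp [hFe, hasSum_zero]
    rw [map_smul, this, smul_zero]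
  · have : (∑' p, F p) (e (i, j + 1)) = (w (i, j) : 𝕜) • e (i, j) := by
      refine (happ _).unique ?_
      have h := hasSum_single (f := fun p => F p (e (i, j + 1))) (i, j) fun p hp => by
        rw [hFe, if_neg]
        rintro h
        apply hp
        simpa [Prod.ext_iff] using h
      simpa [hFe] using h
    rw [map_smul, this, smul_smul, smul_smul]
    congr 1
    simp only [a, Finset.prod_range_succ, Nat.factorial_succ]
    push_cast
    field_simp [hw (i, j)]

/-- The diagonal operator on `ℓ¹(ℕ, X)` induced by an operator on `X`. -/
noncomputable def diagonalOperator (T : X →L[𝕜] X) :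
    lp (fun _ : ℕ => X) 1 →L[𝕜] lp (fun _ : ℕ => X) 1 :=
  lp.mapCLM 1 (fun _ => T) (norm_nonneg T) fun _ => le_rfl

theorem diagonalOperator_pow_apply (T : X →L[𝕜] X) (n : ℕ) (h : lp (fun _ : ℕ => X) 1) (i : ℕ) :
    (diagonalOperator T ^ n) h i = (T ^ n) (h i) := by
  induction n generalizing h with
  | zero => rfl
  | succ n ih => rw [pow_succ, mul_apply_eq_comp, ih, pow_succ, mul_apply_eq_comp]; rfl

theorem diagonalOperator_pow_single (T : X →L[𝕜] X) (n i : ℕ) (x : X) :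
    (diagonalOperator T ^ n) (lp.single 1 i x) = lp.single 1 i ((T ^ n) x) := by
  ext k
  rw [diagonalOperator_pow_apply]
  by_cases hk : k = i
  · subst hk; simp
  · simp [hk]

theorem single_mem_orbitLimitPairs {T : X →L[𝕜] X} {x y : X} (h : (x, y) ∈ orbitLimitPairs T)
    (i : ℕ) : ((lp.single 1 i x : lp (fun _ : ℕ => X) 1), (lp.single 1 i y)) ∈
      orbitLimitPairs (diagonalOperator T) := by
  obtain ⟨z, hz, hz'⟩ := h
  have hcont : Continuous (lp.single (E := fun _ : ℕ => X) 1 i) := (lp.isometry_single i).continuous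
  refine ⟨fun n => lp.single 1 i (z n), (hcont.tendsto x).comp hz, ?_⟩
  simp only [diagonalOperator_pow_single]
  exact (hcont.tendsto y).comp hz'

theorem dense_span_single {D : Set X} (hD : Dense (Submodule.span 𝕜 D : Set X)) :
    Dense (Submodule.span 𝕜 (⋃ i : ℕ, lp.single (E := fun _ : ℕ => X) 1 i '' D) :
      Set (lp (fun _ : ℕ => X) 1)) := by
  set S := Submodule.span 𝕜 (⋃ i : ℕ, lp.single (E := fun _ : ℕ => X) 1 i '' D)
  have hs (i : ℕ) (x : X) : lp.single (E := fun _ : ℕ => X) 1 i x ∈ S.topologicalClosure := by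
    have h1 : Submodule.span 𝕜 D ≤
        S.comap (lp.lsingle (𝕜 := 𝕜) (E := fun _ : ℕ => X) 1 i) :=
      Submodule.span_le.2 fun d hd =>
        Submodule.subset_span (mem_iUnion.2 ⟨i, d, hd, rfl⟩)
    exact map_mem_closure (lp.isometry_single (E := fun _ : ℕ => X) (p := 1) i).continuous (hD x)
      fun y hy => h1 hy
  intro h
  have hsum := lp.hasSum_single (p := 1) (by simp) h
  refine S.isClosed_topologicalClosure.mem_of_tendsto hsum (Eventually.of_forall fun s => ?_)
  exact sum_mem fun i _ => hs i _

/-- A separable infinite-dimensional Banach space carries an operator which is the identity on an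
infinite-dimensional subspace and whose diagonal action on `ℓ¹(ℕ, X)` has a dense orbit. -/
theorem exists_operator_dense_diagonal_orbit [CompleteSpace X] [TopologicalSpace.SeparableSpace X]
    (hX : ¬ FiniteDimensional 𝕜 X) :
    ∃ (T : X →L[𝕜] X) (M : Submodule 𝕜 X) (h : lp (fun _ : ℕ => X) 1),
      IsClosed (M : Set X) ∧ ¬ FiniteDimensional 𝕜 M ∧ (∀ m ∈ M, T m = m) ∧
      Dense (range fun n : ℕ => (diagonalOperator T ^ n) h) := by
  obtain ⟨B, u, hli, hd, h0, hsucc⟩ := exists_backward_shift hX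
  have hchain (i j : ℕ) (a b : 𝕜) :
      (a • u (i, j), b • u (i, j)) ∈ orbitLimitPairs (expOperator B) := by
    set Φ : Polynomial 𝕜 →ₗ[𝕜] X :=
      (Polynomial.basisMonomials 𝕜).constr 𝕜 fun j => u (i, j)
    have hΦ (j : ℕ) : Φ (Polynomial.X ^ j) = u (i, j) := by
      have := (Polynomial.basisMonomials 𝕜).constr_basis 𝕜 (fun j => u (i, j)) j
      rw [Polynomial.coe_basisMonomials] at this
      beta_reduce at this
      rwa [Polynomial.monomial_one_right_eq_X_pow] at this
    have hB (p : Polynomial 𝕜) : B (Φ p) = Φ (Polynomial.derivative p) := by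
      induction p using Polynomial.induction_on' with
      | add p q hp hq => simp [hp, hq]
      | monomial j a =>
        rw [← Polynomial.C_mul_X_pow_eq_monomial, ← Polynomial.smul_eq_C_mul]
        simp only [map_smul, hΦ]
        congr 1
        cases j with
        | zero => simp [h0]
        | succ j =>
          rw [hsucc, Polynomial.derivative_X_pow, ← Polynomial.smul_eq_C_mul, map_smul,
            Nat.add_sub_cancel, hΦ]
    rw [← hΦ]
    exact mem_orbitLimitPairs_expOperator hB j a b
  have hdense := dense_span_single hd
  obtain ⟨h, hh⟩ := exists_dense_orbit (diagonalOperator (expOperator B))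
    (countable_iUnion fun i => (countable_range u).image _) hdense (by
      intro d hd
      obtain ⟨i, _, ⟨⟨k, j⟩, rfl⟩, rfl⟩ := mem_iUnion.1 hd
      constructor
      · simpa using single_mem_orbitLimitPairs (hchain k j 1 0) i
      · simpa using single_mem_orbitLimitPairs (hchain k j 0 1) i)
  refine ⟨expOperator B, LinearMap.ker (B : X →ₗ[𝕜] X), h, B.isClosed_ker, fun hfin => ?_,
    fun m hm => expOperator_apply_of_apply_eq_zero hm, hh⟩
  have hli' : LinearIndependent 𝕜 fun i : ℕ =>
      (⟨u (i, 0), h0 i⟩ : LinearMap.ker (B : X →ₗ[𝕜] X)) := by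
    refine LinearIndependent.of_comp (LinearMap.ker (B : X →ₗ[𝕜] X)).subtype ?_
    exact hli.comp (fun i : ℕ => (i, 0)) fun i j h => (Prod.ext_iff.1 h).1
  exact not_finite_iff_infinite.2 inferInstance hli'.finite

end Construction

/-! ### Hypercyclic subspaces by nuclear perturbation -/

section Disjointness

open Filter Topology Set

variable {𝕜 X : Type*} [RCLike 𝕜] [NormedAddCommGroup X] [NormedSpace 𝕜 X]

theorem exists_units_eq_one_add_smul [CompleteSpace X] (R : X →L[𝕜] X) :
    ∃ (c : 𝕜) (L : (X →L[𝕜] X)ˣ), c ≠ 0 ∧ (L : X →L[𝕜] X) = 1 + c • R := by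
  have hpos : 0 < ‖R‖ + 1 := by positivity
  set c : 𝕜 := RCLike.ofReal (‖R‖ + 1)⁻¹
  have hc : c ≠ 0 := by
    simp only [c, ne_eq, RCLike.ofReal_eq_zero]
    positivity
  have hlt : ‖-(c • R)‖ < 1 := by
    rw [norm_neg, norm_smul, RCLike.norm_ofReal, abs_of_pos (inv_pos.2 hpos),
      inv_mul_lt_iff₀ hpos]
    linarith
  exact ⟨c, Units.oneSub _ hlt, hc, by simp⟩

theorem Units.inv_apply_apply_self (L : (X →L[𝕜] X)ˣ) (x : X) :
    (↑L⁻¹ : X →L[𝕜] X) ((L : X →L[𝕜] X) x) = x := by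
  rw [← mul_apply_eq_comp, Units.inv_mul]; rfl

theorem Units.apply_inv_apply_self (L : (X →L[𝕜] X)ˣ) (x : X) :
    (L : X →L[𝕜] X) ((↑L⁻¹ : X →L[𝕜] X) x) = x := by
  rw [← mul_apply_eq_comp, Units.mul_inv]; rfl

theorem Units.conj_pow_apply (L : (X →L[𝕜] X)ˣ) (T : X →L[𝕜] X) (n : ℕ) (x : X) :
    ((↑L⁻¹ * T * ↑L : X →L[𝕜] X) ^ n) x =
      (↑L⁻¹ : X →L[𝕜] X) ((T ^ n) ((L : X →L[𝕜] X) x)) := by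
  rw [Units.conj_pow', mul_apply_eq_comp, mul_apply_eq_comp]

/-- Norming functionals of a dense sequence: if all vanish at `x`, a nearby `y` has `‖y‖ ≤ ‖x - y‖`,
so `x` is arbitrarily small. -/
theorem exists_separating_sequence [TopologicalSpace.SeparableSpace X] :
    ∃ f : ℕ → StrongDual 𝕜 X, (∀ i, ‖f i‖ ≤ 1) ∧ ∀ x : X, (∀ i, f i x = 0) → x = 0 := by
  choose f hf hfx using fun i : ℕ => exists_dual_vector'' 𝕜 (TopologicalSpace.denseSeq X i)
  refine ⟨f, hf, fun x hx => norm_le_zero_iff.1 (le_of_forall_pos_lt_add fun ε hε => ?_)⟩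
  obtain ⟨i, hi⟩ := (TopologicalSpace.denseRange_denseSeq X).exists_dist_lt x (half_pos hε)
  set y := TopologicalSpace.denseSeq X i
  rw [dist_eq_norm] at hi
  have h1 : ‖y‖ ≤ ‖x - y‖ := by
    have h2 : ‖f i (x - y)‖ = ‖y‖ := by
      rw [map_sub, hx, zero_sub, norm_neg, hfx, RCLike.norm_ofReal, abs_norm]
    calc ‖y‖ = ‖f i (x - y)‖ := h2.symm
      _ ≤ ‖f i‖ * ‖x - y‖ := (f i).le_opNorm _
      _ ≤ 1 * ‖x - y‖ := by gcongr; exact hf i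
      _ = ‖x - y‖ := one_mul _
  have h3 : ‖x‖ ≤ ‖x - y‖ + ‖y‖ := by simpa using norm_add_le (x - y) y
  linarith

theorem norm_apply_smul_id_le {g : StrongDual 𝕜 X} (hg : ‖g‖ ≤ 1) (m : X) :
    ‖g m • ContinuousLinearMap.id 𝕜 X‖ ≤ ‖m‖ := by
  refine (norm_smul_le (g m) (ContinuousLinearMap.id 𝕜 X)).trans ?_
  refine (mul_le_of_le_one_right (norm_nonneg _) ContinuousLinearMap.norm_id_le).trans ?_
  simpa using g.le_of_opNorm_le hg m

/-- The operator `h ↦ ∑ i, f i m • h i` from `ℓ¹(ℕ, X)` to `X`. -/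
noncomputable def weightedSum [CompleteSpace X] (f : ℕ → StrongDual 𝕜 X) (hf : ∀ i, ‖f i‖ ≤ 1)
    (m : X) : lp (fun _ : ℕ => X) 1 →L[𝕜] X :=
  lp.tsumCLM 𝕜 ℕ X ∘L lp.mapCLM 1 (fun i => f i m • ContinuousLinearMap.id 𝕜 X)
    (norm_nonneg m) fun i => norm_apply_smul_id_le (hf i) m

section WeightedSum

variable [CompleteSpace X] {f : ℕ → StrongDual 𝕜 X} (hf : ∀ i, ‖f i‖ ≤ 1)

theorem weightedSum_apply (m : X) (h : lp (fun _ : ℕ => X) 1) :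
    weightedSum f hf m h = ∑' i, f i m • h i := rfl

theorem weightedSum_surjective {m : X} (hm : ∃ i, f i m ≠ 0) :
    Function.Surjective (weightedSum f hf m) := by
  obtain ⟨i, hi⟩ := hm
  refine fun x => ⟨lp.single 1 i ((f i m)⁻¹ • x), ?_⟩
  rw [weightedSum_apply, tsum_eq_single i]
  · simp [smul_smul, hi]
  · intro k hk
    simp [hk]

theorem summable_smul_apply (hf : ∀ i, ‖f i‖ ≤ 1) (m : X) (h : lp (fun _ : ℕ => X) 1) :
    Summable fun i => f i m • h i :=
  (lp.memℓp (lp.mapCLM 1 (fun i => f i m • ContinuousLinearMap.id 𝕜 X)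
    (norm_nonneg m) (fun i => norm_apply_smul_id_le (hf i) m) h)).summable_of_one

/-- This intertwining carries a dense orbit in `ℓ¹(ℕ, X)` to a dense orbit in `X`, simultaneously
for all `m ≠ 0`. -/
theorem weightedSum_diagonalOperator_pow (T : X →L[𝕜] X) (m : X) (n : ℕ)
    (h : lp (fun _ : ℕ => X) 1) :
    weightedSum f hf m ((diagonalOperator T ^ n) h) = (T ^ n) (weightedSum f hf m h) := by
  simp only [weightedSum_apply, diagonalOperator_pow_apply]
  rw [(T ^ n).map_tsum (summable_smul_apply hf m h)]
  simp only [map_smul]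

/-- The nuclear operator `m ↦ ∑ i, f i m • h i`. -/
theorem exists_nuclearOperator (h : lp (fun _ : ℕ => X) 1) :
    ∃ R : X →L[𝕜] X, ∀ m, R m = weightedSum f hf m h := by
  have hs : Summable fun i => (f i).smulRight (h i) := by
    have hn : Summable fun i => ‖h i‖ := by
      simpa using (lp.memℓp h).summable (by simp)
    refine Summable.of_norm_bounded hn fun i => ?_
    rw [ContinuousLinearMap.norm_smulRight_apply]
    exact mul_le_of_le_one_left (norm_nonneg _) (hf i)
  refine ⟨∑' i, (f i).smulRight (h i), fun m => ?_⟩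
  exact (hs.hasSum.mapL (ContinuousLinearMap.apply 𝕜 X m)).tsum_eq.symm

end WeightedSum

theorem dense_range_map {α E F : Type*} [TopologicalSpace E] [TopologicalSpace F] {o : α → E}
    (ho : Dense (range o)) {A : E → F} (hA : Continuous A) (hs : Function.Surjective A) :
    Dense (range fun n => A (o n)) :=
  DenseRange.comp (f := o) (g := A) hs.denseRange ho hA

theorem not_finiteDimensional_inf_ker {Y : Submodule 𝕜 X} (hY : ¬ FiniteDimensional 𝕜 Y)
    (f : X →ₗ[𝕜] 𝕜) : ¬ FiniteDimensional 𝕜 ↥(Y ⊓ LinearMap.ker f) := fun h =>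
  hY (Module.Finite.iff_fg.2 (Submodule.fg_of_fg_map_of_fg_inf_ker f
    (IsNoetherian.noetherian _) (Module.Finite.iff_fg.1 h)))

/-- An operator acting as the identity on `M`, with a dense diagonal orbit in `ℓ¹(ℕ, X)`, has a
hypercyclic subspace. -/
theorem exists_isHypercyclicSubspace [CompleteSpace X] [TopologicalSpace.SeparableSpace X]
    {T : X →L[𝕜] X} {M : Submodule 𝕜 X} {h : lp (fun _ : ℕ => X) 1}
    (hMc : IsClosed (M : Set X)) (hM : ¬ FiniteDimensional 𝕜 M) (hTM : ∀ m ∈ M, T m = m)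
    (hh : Dense (range fun n : ℕ => (diagonalOperator T ^ n) h)) :
    ∃ Y : Submodule 𝕜 X, IsHypercyclicSubspace T Y := by
  obtain ⟨f, hf, hsep⟩ := exists_separating_sequence (𝕜 := 𝕜) (X := X)
  obtain ⟨R, hR⟩ := exists_nuclearOperator hf h
  obtain ⟨c, S, hc, hS⟩ := exists_units_eq_one_add_smul R
  have hpow (n : ℕ) {m : X} (hm : m ∈ M) : (T ^ n) m = m := by
    induction n with
    | zero => rfl
    | succ n ih => rw [pow_succ, mul_apply_eq_comp, hTM m hm, ih]
  -- This is `S(M)`, written as a preimage so that closedness is immediate.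
  refine ⟨M.comap ((↑S⁻¹ : X →L[𝕜] X) : X →ₗ[𝕜] X),
    hMc.preimage (↑S⁻¹ : X →L[𝕜] X).continuous, fun hfin => hM ?_, fun y hy hy0 => ?_⟩
  · have hmap : M ≤ (M.comap ((↑S⁻¹ : X →L[𝕜] X) : X →ₗ[𝕜] X)).map
        ((↑S⁻¹ : X →L[𝕜] X) : X →ₗ[𝕜] X) := fun m hm => by
      refine ⟨(S : X →L[𝕜] X) m, ?_, Units.inv_apply_apply_self S m⟩
      change (↑S⁻¹ : X →L[𝕜] X) ((S : X →L[𝕜] X) m) ∈ M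
      rwa [Units.inv_apply_apply_self]
    exact Submodule.finiteDimensional_of_le hmap
  · obtain ⟨m, hm, rfl⟩ : ∃ m ∈ M, y = (S : X →L[𝕜] X) m :=
      ⟨_, hy, (Units.apply_inv_apply_self S y).symm⟩
    have hm0 : ∃ i, f i m ≠ 0 := by
      by_contra! hcon
      exact hy0 (by rw [hsep m hcon, map_zero])
    have horb (n : ℕ) : (T ^ n) ((S : X →L[𝕜] X) m) =
        m + c • weightedSum f hf m ((diagonalOperator T ^ n) h) := by
      have hSm : (S : X →L[𝕜] X) m = m + c • weightedSum f hf m h := by simp [hS, hR]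
      rw [weightedSum_diagonalOperator_pow, hSm, map_add, map_smul, hpow n hm]
    simp only [hypercyclicVectors, mem_ofPred_eq, horb]
    refine dense_range_map hh (A := fun g => m + c • weightedSum f hf m g) (by fun_prop) fun x => ?_
    obtain ⟨g, hg⟩ := weightedSum_surjective hf hm0 (c⁻¹ • (x - m))
    exact ⟨g, by simp [hg, smul_smul, hc]⟩

/-! ### Conjugation by a rank-one perturbation of the identity -/

section RankOneConjugate

variable {T : X →L[𝕜] X} {L : (X →L[𝕜] X)ˣ} {f : StrongDual 𝕜 X} {v : X}

theorem apply_ne_zero_of_mem_dHypercyclicVectors [Nontrivial X]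
    (hL : ∀ x, (L : X →L[𝕜] X) x = x + f x • v) {x : X}
    (hx : x ∈ dHypercyclicVectors ![T, ↑L⁻¹ * T * ↑L]) : f x ≠ 0 := by
  intro hfx
  -- A proper closed set that traps the joint orbit when `f x = 0`.
  set C : Set (Fin 2 → X) := {p | (L : X →L[𝕜] X) (p 1) = p 0}
  have hC : IsClosed C := isClosed_eq ((L : X →L[𝕜] X).continuous.comp (continuous_apply 1))
    (continuous_apply 0)
  have hsub : (range fun n : ℕ => fun i : Fin 2 =>
      ((![T, ↑L⁻¹ * T * ↑L] : Fin 2 → (X →L[𝕜] X)) i ^ n) x) ⊆ C := by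
    rintro _ ⟨n, rfl⟩
    have hLx : (L : X →L[𝕜] X) x = x := by simp [hL, hfx]
    change (L : X →L[𝕜] X) (((↑L⁻¹ * T * ↑L : X →L[𝕜] X) ^ n) x) = (T ^ n) x
    rw [Units.conj_pow_apply, Units.apply_inv_apply_self, hLx]
  have huniv : C = univ := hC.closure_eq ▸ (Dense.mono hsub hx).closure_eq
  obtain ⟨y, hy⟩ := exists_ne (0 : X)
  have : (![y, 0] : Fin 2 → X) ∈ C := huniv ▸ mem_univ _
  exact hy (by simpa [C] using this.symm)

theorem finrank_eq_one_of_subset_dHypercyclicVectors [Nontrivial X]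
    (hL : ∀ x, (L : X →L[𝕜] X) x = x + f x • v) {W : Submodule 𝕜 X} (hW : W ≠ ⊥)
    (hsub : (W : Set X) ⊆ dHypercyclicVectors ![T, ↑L⁻¹ * T * ↑L] ∪ {0}) :
    Module.finrank 𝕜 W = 1 := by
  have hinj : Function.Injective ((f : X →ₗ[𝕜] 𝕜).domRestrict W) := by
    rw [injective_iff_map_eq_zero]
    intro w hw
    rcases hsub w.2 with h | h
    · exact absurd hw (apply_ne_zero_of_mem_dHypercyclicVectors hL h)
    · exact Subtype.ext h
  have hle := LinearMap.finrank_le_finrank_of_injective hinj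
  rw [Module.finrank_self] at hle
  have : FiniteDimensional 𝕜 W := Module.Finite.of_injective _ hinj
  have : Nontrivial W := (Submodule.nontrivial_iff_ne_bot).2 hW
  have hpos : 0 < Module.finrank 𝕜 W := Module.finrank_pos
  omega

theorem mem_dHypercyclicVectors_of_dense
    (hL : ∀ x, (L : X →L[𝕜] X) x = x + f x • v) {x : X} (hfx : f x ≠ 0)
    (hd : Dense (range fun n : ℕ => ((T ^ n) x, (T ^ n) v))) :
    x ∈ dHypercyclicVectors ![T, ↑L⁻¹ * T * ↑L] := by
  set A : X × X → (Fin 2 → X) := fun p => ![p.1, (↑L⁻¹ : X →L[𝕜] X) (p.1 + f x • p.2)]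
  have hA : Continuous A := by
    refine continuous_pi fun i => ?_
    fin_cases i
    · exact continuous_fst
    · exact (↑L⁻¹ : X →L[𝕜] X).continuous.comp
        (continuous_fst.add (continuous_snd.const_smul (f x)))
  have hs : Function.Surjective A := fun p =>
    ⟨(p 0, (f x)⁻¹ • ((L : X →L[𝕜] X) (p 1) - p 0)), by
      ext i
      fin_cases i
      · rfl
      · simp [A, smul_smul, hfx, Units.inv_apply_apply_self]⟩
  have horb : (fun n : ℕ => fun i : Fin 2 =>
      ((![T, ↑L⁻¹ * T * ↑L] : Fin 2 → (X →L[𝕜] X)) i ^ n) x) =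
      fun n : ℕ => A ((T ^ n) x, (T ^ n) v) := by
    ext n i
    fin_cases i
    · rfl
    · change ((↑L⁻¹ * T * ↑L : X →L[𝕜] X) ^ n) x =
        (↑L⁻¹ : X →L[𝕜] X) ((T ^ n) x + f x • (T ^ n) v)
      rw [Units.conj_pow_apply, hL, map_add, map_smul]
  change Dense (range _)
  rw [horb]
  exact dense_range_map hd hA hs

theorem denselyDHypercyclic_of_dense_diagonal_orbit [CompleteSpace X] {h : lp (fun _ : ℕ => X) 1}
    (hL : ∀ x, (L : X →L[𝕜] X) x = x + f x • h 0) (hf : f ≠ 0)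
    (hh : Dense (range fun n : ℕ => (diagonalOperator T ^ n) h)) :
    DenselyDHypercyclic ![T, ↑L⁻¹ * T * ↑L] := by
  set ev : ℕ → lp (fun _ : ℕ => X) 1 →L[𝕜] X := fun i => lp.evalCLM 𝕜 (fun _ : ℕ => X) 1 i
  have hev (i : ℕ) (g : lp (fun _ : ℕ => X) 1) : ev i g = g i := rfl
  have hdense : Dense (range fun k : ℕ => h 1 + (T ^ k) (h 0)) := by
    have := dense_range_map hh (A := fun g => h 1 + ev 0 g) (by fun_prop)
      fun x => ⟨lp.single 1 0 (x - h 1), by simp [hev]⟩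
    simpa only [hev, diagonalOperator_pow_apply] using this
  have hopen : IsOpen {x : X | f x ≠ 0} := isOpen_ne_fun f.continuous continuous_const
  have hne : Dense {x : X | f x ≠ 0} := by
    have : {x : X | f x ≠ 0} = ((LinearMap.ker (f : X →ₗ[𝕜] 𝕜) : Submodule 𝕜 X) : Set X)ᶜ := rfl
    rw [this, ← interior_eq_empty_iff_dense_compl, ← not_nonempty_iff_eq_empty]
    intro hint
    have htop := Submodule.eq_top_of_nonempty_interior' _ hint
    exact hf (ContinuousLinearMap.ext fun x => LinearMap.mem_ker.1 (htop.ge (Submodule.mem_top (x := x))))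
  refine (hdense.inter_of_isOpen_right hne hopen).mono ?_
  rintro _ ⟨⟨k, rfl⟩, hx⟩
  refine mem_dHypercyclicVectors_of_dense hL hx ?_
  -- Powers of `T` commute, so the joint orbit of `(h 1 + Tᵏ(h 0), h 0)` is a surjective linear
  -- image of the orbit of `h`.
  have := dense_range_map hh (A := fun g => (ev 1 g + (T ^ k) (ev 0 g), ev 0 g)) (by fun_prop)
    fun p => ⟨lp.single 1 0 p.2 + lp.single 1 1 (p.1 - (T ^ k) p.2), by simp [hev]⟩
  convert this using 3 with n
  simp only [hev, diagonalOperator_pow_apply, map_add, ← mul_apply_eq_comp, ← pow_add, add_comm]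

theorem IsHypercyclicSubspace.inf_ker_conj {Y : Submodule 𝕜 X} (hY : IsHypercyclicSubspace T Y)
    (hL : ∀ x, (L : X →L[𝕜] X) x = x + f x • v) :
    IsHypercyclicSubspace T (Y ⊓ LinearMap.ker (f : X →ₗ[𝕜] 𝕜)) ∧
      IsHypercyclicSubspace (↑L⁻¹ * T * ↑L : X →L[𝕜] X) (Y ⊓ LinearMap.ker (f : X →ₗ[𝕜] 𝕜)) := by
  obtain ⟨hc, hinf, hhc⟩ := hY
  have hc' : IsClosed ((Y ⊓ LinearMap.ker (f : X →ₗ[𝕜] 𝕜) : Submodule 𝕜 X) : Set X) :=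
    hc.inter f.isClosed_ker
  have hinf' := not_finiteDimensional_inf_ker hinf (f : X →ₗ[𝕜] 𝕜)
  refine ⟨⟨hc', hinf', fun y hy => hhc y hy.1⟩, hc', hinf', fun y hy hy0 => ?_⟩
  have hfy : f y = 0 := hy.2
  have hLy : (L : X →L[𝕜] X) y = y := by simp [hL, hfy]
  have := dense_range_map (hhc y hy.1 hy0) (↑L⁻¹ : X →L[𝕜] X).continuous
    fun x => ⟨_, Units.inv_apply_apply_self L x⟩
  simpa only [hypercyclicVectors, mem_ofPred_eq, Units.conj_pow_apply, hLy] using this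

end RankOneConjugate

end Disjointness

theorem corollary3p2 {𝕜 X : Type*} [RCLike 𝕜] [NormedAddCommGroup X] [NormedSpace 𝕜 X]
    [CompleteSpace X] [TopologicalSpace.SeparableSpace X] (hX : ¬ FiniteDimensional 𝕜 X) :
    ∃ T₁ T₂ : X →L[𝕜] X,
      DenselyDHypercyclic ![T₁, T₂] ∧
      (∃ Y : Submodule 𝕜 X, IsHypercyclicSubspace T₁ Y ∧ IsHypercyclicSubspace T₂ Y) ∧
      (¬ ∃ Y : Submodule 𝕜 X, IsDHypercyclicSubspace ![T₁, T₂] Y) ∧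
      (∀ W : Submodule 𝕜 X, W ≠ ⊥ →
        (W : Set X) ⊆ dHypercyclicVectors ![T₁, T₂] ∪ {0} → Module.finrank 𝕜 W = 1) := by
  obtain ⟨T, M, h, hMc, hM, hTM, hh⟩ := exists_operator_dense_diagonal_orbit hX
  have : Nontrivial X := by
    by_contra hn
    rw [not_nontrivial_iff_subsingleton] at hn
    exact hX inferInstance
  obtain ⟨f, hf⟩ := exists_ne (0 : StrongDual 𝕜 X)
  obtain ⟨c, L, hc, hL⟩ := exists_units_eq_one_add_smul (f.smulRight (h 0))
  have hL' (x : X) : (L : X →L[𝕜] X) x = x + (c • f) x • h 0 := by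
    simp [hL, smul_smul]
  have hdim : ∀ W : Submodule 𝕜 X, W ≠ ⊥ →
      (W : Set X) ⊆ dHypercyclicVectors ![T, (↑L⁻¹ * T * ↑L : X →L[𝕜] X)] ∪ {0} →
      Module.finrank 𝕜 W = 1 :=
    fun W hW hsub => finrank_eq_one_of_subset_dHypercyclicVectors hL' hW hsub
  obtain ⟨Y, hY⟩ := exists_isHypercyclicSubspace hMc hM hTM hh
  have hdense := denselyDHypercyclic_of_dense_diagonal_orbit hL' (smul_ne_zero hc hf) hh
  have hcommon := hY.inf_ker_conj hL'
  generalize (↑L⁻¹ * T * ↑L : X →L[𝕜] X) = T₂ at hdim hdense hcommon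
  refine ⟨T, T₂, hdense, ⟨_, hcommon⟩, ?_, hdim⟩
  rintro ⟨Z, -, hZ, hZd⟩
  have hZ0 : Z ≠ ⊥ := by
    rintro rfl
    exact hZ inferInstance
  -- `finrank` is 0 by default in infinite dimension, so the value 1 does force finiteness.
  refine hZ (Module.finite_of_finrank_eq_succ (hdim Z hZ0 fun z hz => ?_))
  by_cases h0 : z = 0
  · exact Or.inr h0
  · exact Or.inl (hZd z hz h0)
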